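/- **Setting.** All graphs are finite, and $t\ge 1$ is an integer. Let $H=S_k$ ($k\ge 2$) be the star with vertex set $\{v_1,\dots,v_k\}$ and centre $v_1$. Let $p_i,q_i\ge 0$ be integers such that $n_i:=tp_i+q_i\ge 1$ for $1\le i\le k$. Let $G=H_{p_1,\dots,p_k}^{q_1,\dots,q_k}$ be the generalized blow-up of $H$: each $v_i$ is replaced by the disjoint union $G_i=p_iK_t\cup q_iK_1$ of $p_i$ copies of the complete graph $K_t$ and $q_i$ isolated vertices, and every vertex of $G_i$ is joined to every vertex of $G_j$ whenever $v_iv_j\in E(H)$. Put $n=|V(G)|=n_1+\dots+n_k$, and write $V_i^{p_i}$ and $V_i^{q_i}$ for the sets of vertices of $p_iK_t$ and of $q_iK_1$ in $G_i$. Let $R_G(u,v)$ be the resistance distance, i.e. the potential difference between $u$ and $v$ when every edge of $G$ is a unit resistor and a unit current enters at $u$ and leaves at $v$. **Corollary.** The following hold. (i) For distinct $u,v\in V_1^{p_1}\cup V_1^{q_1}$, $$R_G(u,v)=\begin{cases} \dfrac{2}{n-n_1}, & u,v\in V_1^{q_1};\\[2mm] \dfrac{2(n-n_1)+t+1}{(n-n_1)(t+n-n_1)},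 & u\in V_1^{p_1},\ v\in V_1^{q_1};\\[2mm] \dfrac{2}{t+n-n_1}, & u,v\in V_1^{p_1},\ uv\in E(G);\\[2mm] \dfrac{2(1+n-n_1)}{(n-n_1)(t+n-n_1)}, & u,v\in V_1^{p_1},\ uv\notin E(G). \end{cases}$$ (ii) For $2\le i\le k$ and distinct $u,v\in V_i^{p_i}\cup V_i^{q_i}$, $$R_G(u,v)=\begin{cases} \dfrac{2}{n_1}, & u,v\in V_i^{q_i};\\[2mm] \dfrac{2n_1+t+1}{n_1(n_1+t)}, & u\in V_i^{p_i},\ v\in V_i^{q_i};\\[2mm] \dfrac{2}{n_1+t}, & u,v\in V_i^{p_i},\ uv\in E(G);\\[2mm] \dfrac{2(n_1+1)}{n_1(n_1+t)}, & u,v\in V_i^{p_i},\ uv\notin E(G). \end{cases}$$ (iii) For $2\le i\le k$, $u\in V_1^{p_1}\cup V_1^{q_1}$ and $v\in V_i^{p_i}\cup V_i^{q_i}$, $$R_G(u,v)=\begin{cases} \dfrac{n-1}{n_1(n-n_1)}, & u\in V_1^{q_1},\ v\in V_i^{q_i};\\[2mm] \dfrac{n_1-1}{n_1(n-n_1)}+\dfrac{n_1+1}{n_1(t+n_1)},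 & u\in V_1^{q_1},\ v\in V_i^{p_i};\\[2mm] \dfrac{n-n_1+1}{(n-n_1)(n-n_1+t)}+\dfrac{n-n_1-1}{n_1(n-n_1)}, & u\in V_1^{p_1},\ v\in V_i^{q_i};\\[2mm] \dfrac{(n_1-1)(n-n_1+1)+1-t}{n_1(n-n_1)(n-n_1+t)}+\dfrac{n_1+1}{n_1(t+n_1)}, & u\in V_1^{p_1},\ v\in V_i^{p_i}. \end{cases}$$ (iv) For $2\le i\ne j\le k$, $u\in V_i^{p_i}\cup V_i^{q_i}$ and $v\in V_j^{p_j}\cup V_j^{q_j}$, $$R_G(u,v)=\begin{cases} \dfrac{2}{n_1}, & u\in V_i^{q_i},\ v\in V_j^{q_j};\\[2mm] \dfrac{2n_1+t+1}{n_1(n_1+t)}, & u\in V_i^{p_i},\ v\in V_j^{q_j};\\[2mm] \dfrac{2(n_1+1)}{n_1(n_1+t)}, & u\in V_i^{p_i},\ v\in V_j^{p_j}. \end{cases}$$ -/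

import Mathlib

open scoped BigOperators

open Classical in
/-- `φ` is an electric potential on the vertices of `G` when every edge is a resistor of one ohm,
a unit current enters at `u` and leaves at `v`: by Ohm's law the current along the edge `xy` is
`φ x - φ y`, and Kirchhoff's current law holds at each vertex. -/
def IsUnitCurrentPotential {V : Type*} [Fintype V] (G : SimpleGraph V) (u v : V)
    (φ : V → ℝ) : Prop :=
  ∀ x : V, ∑ y : V, (if G.Adj x y then φ x - φ y else 0)
    = (if x = u then 1 else 0) - (if x = v then 1 else 0)

open Classical in
/-- The resistance distance between `u` and `v`: the potential difference between `u` and `v` when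
a unit current is sent from `u` to `v` (and, by convention, `0` if no such current exists, i.e. if
`u` and `v` lie in different components). It does not depend on the potential, as
`resistanceDist_eq` shows. -/
noncomputable def resistanceDist {V : Type*} [Fintype V] (G : SimpleGraph V) (u v : V) : ℝ :=
  if h : ∃ φ : V → ℝ, IsUnitCurrentPotential G u v φ then h.choose u - h.choose v else 0

open Classical in
theorem sum_mul_unitCurrent {V : Type*} [Fintype V] {G : SimpleGraph V} {u v : V}
    {φ : V → ℝ} (h : IsUnitCurrentPotential G u v φ) (ψ : V → ℝ) :
    ∑ x : V, ψ x * ∑ y : V, (if G.Adj x y then φ x - φ y else 0) = ψ u - ψ v := by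
  simp only [h _, mul_sub, Finset.sum_sub_distrib, mul_ite, mul_one, mul_zero,
    Finset.sum_ite_eq', Finset.mem_univ, if_true]

open Classical in
theorem sum_mul_laplacian_comm {V : Type*} [Fintype V] (G : SimpleGraph V) (φ ψ : V → ℝ) :
    ∑ x : V, ψ x * ∑ y : V, (if G.Adj x y then φ x - φ y else 0)
      = ∑ x : V, φ x * ∑ y : V, (if G.Adj x y then ψ x - ψ y else 0) := by
  rw [← sub_eq_zero, ← Finset.sum_sub_distrib]
  simp only [Finset.mul_sum, ← Finset.sum_sub_distrib]
  have key : ∀ x y : V, ψ x * (if G.Adj x y then φ x - φ y else 0)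
      - φ x * (if G.Adj x y then ψ x - ψ y else 0)
      = (if G.Adj x y then φ x * ψ y else 0) - (if G.Adj y x then φ y * ψ x else 0) := by
    intro x y
    by_cases hxy : G.Adj x y
    · simp only [hxy, hxy.symm, if_true]; ring
    · have hyx : ¬ G.Adj y x := fun hyx => hxy hyx.symm
      simp only [hxy, hyx, if_false]; ring
  simp only [key, Finset.sum_sub_distrib]
  rw [sub_eq_zero]
  exact Finset.sum_comm

/-- The resistance distance is well defined: any unit current potential computes it. -/
theorem resistanceDist_eq {V : Type*} [Fintype V] {G : SimpleGraph V} {u v : V} {φ : V → ℝ}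
    (h : IsUnitCurrentPotential G u v φ) : resistanceDist G u v = φ u - φ v := by
  have hex : ∃ φ : V → ℝ, IsUnitCurrentPotential G u v φ := ⟨φ, h⟩
  rw [resistanceDist, dif_pos hex, ← sum_mul_unitCurrent h, sum_mul_laplacian_comm,
    sum_mul_unitCurrent hex.choose_spec]

/-- The generalized join `H[G₁, …, G_k]`: every vertex `i` of `H` is replaced by the graph `G i`,
and every vertex of `G i` is joined to every vertex of `G j` whenever `i` and `j` are adjacent
in `H`. -/
def generalizedJoin {ι : Type*} {W : ι → Type*} (H : SimpleGraph ι)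
    (G : ∀ i, SimpleGraph (W i)) : SimpleGraph (Σ i, W i) where
  Adj x y := H.Adj x.1 y.1 ∨ ∃ (i : ι) (a b : W i), x = ⟨i, a⟩ ∧ y = ⟨i, b⟩ ∧ (G i).Adj a b
  symm := ⟨by
    rintro x y (h | ⟨i, a, b, hx, hy, h⟩)
    · exact Or.inl h.symm
    · exact Or.inr ⟨i, b, a, hy, hx, h.symm⟩⟩
  loopless := ⟨by
    rintro x (h | ⟨i, a, b, hx, hy, h⟩)
    · exact H.irrefl h
    · obtain rfl : a = b := by simpa using hx.symm.trans hy
      exact (G i).irrefl h⟩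

/-- The disjoint union `p K_t ∪ q K_1`. The vertex `Sum.inl (a, x)` is the `x`-th vertex of the
`a`-th copy of `K_t`; the vertex `Sum.inr b` is the `b`-th isolated vertex. (The box product of an
edgeless graph on `p` vertices with `K_t` is the disjoint union of `p` copies of `K_t`.) -/
def cliquesAndPoints (t p q : ℕ) : SimpleGraph ((Fin p × Fin t) ⊕ Fin q) :=
  SimpleGraph.sum
    (SimpleGraph.boxProd (⊥ : SimpleGraph (Fin p)) (⊤ : SimpleGraph (Fin t)))
    (⊥ : SimpleGraph (Fin q))

/-- The vertex set of the generalized blow-up of a graph on `Fin k`. -/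
abbrev BlowUpVertex {k : ℕ} (t : ℕ) (p q : Fin k → ℕ) : Type :=
  Σ i : Fin k, (Fin (p i) × Fin t) ⊕ Fin (q i)

/-- The generalized blow-up `H_{p₁,…,p_k}^{q₁,…,q_k}`: the generalized join
`H[G₁, …, G_k]` with `G_i = p_i K_t ∪ q_i K_1`. -/
def generalizedBlowUp {k : ℕ} (H : SimpleGraph (Fin k)) (t : ℕ) (p q : Fin k → ℕ) :
    SimpleGraph (BlowUpVertex t p q) :=
  generalizedJoin H fun i => cliquesAndPoints t (p i) (q i)

/-- The set `V_i^{p_i}` of the vertices of `p_i K_t` in the `i`-th part. -/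
def cliquePart {k : ℕ} (t : ℕ) (p q : Fin k → ℕ) (i : Fin k) : Set (BlowUpVertex t p q) :=
  Set.range fun c : Fin (p i) × Fin t => ⟨i, Sum.inl c⟩

/-- The set `V_i^{q_i}` of the vertices of `q_i K_1` in the `i`-th part. -/
def pointPart {k : ℕ} (t : ℕ) (p q : Fin k → ℕ) (i : Fin k) : Set (BlowUpVertex t p q) :=
  Set.range fun b : Fin (q i) => ⟨i, Sum.inr b⟩

/-! The leaves of a star are pairwise non-adjacent, so their parts together form one side and the
part of the centre the other: the blow-up is a join of two disjoint unions of cliques (copies of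
$K_t$ and $K_1$). Any potential computes the resistance (`resistanceDist_eq`), so it is enough to
exhibit one for each pair.

Let $u$ have $d_u$ vertices on the opposite side and a block $B$ of size $s$. The function $f_u =
(1_u + 1_B/d_u)/(d_u+s)$ has Laplacian $1_u - 1_{opp}/d_u$: current enters at $u$ and drains evenly
into the opposite side (`laplacian_blockPotential`). If $u$ and $v$ share a side, the drains of
$f_u$ and $f_v$ cancel in $f_u - f_v$. If not, they are cancelled by a multiple of the indicator of
one side, whose Laplacian is constant on each side.

The resistance thus depends only on $d_u$, $d_v$ and the block sizes, which are $1$ or $t$. -/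

/-- `G` is the join of two graphs (on the vertices with a given value of `side`), each of which is a
disjoint union of complete graphs (on the vertices with a given value of `block`). -/
structure IsJoinOfCliques {V β : Type*} (G : SimpleGraph V) (side : V → Bool) (block : V → β) :
    Prop where
  side_eq : ∀ {x y}, block x = block y → side x = side y
  adj_iff : ∀ x y, G.Adj x y ↔ side x ≠ side y ∨ (x ≠ y ∧ block x = block y)

open Classical in
/-- The number of vertices on the other side of `u`. -/
noncomputable def oppositeCard {V : Type*} [Fintype V] (side : V → Bool) (u : V) : ℝ :=
  ∑ y : V, if side u ≠ side y then 1 else 0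

open Classical in
/-- The number of vertices in the block of `u`. -/
noncomputable def blockCard {V β : Type*} [Fintype V] (block : V → β) (u : V) : ℝ :=
  ∑ y : V, if block u = block y then 1 else 0

open Classical in
/-- The potential supported on the block of `u` that sends a unit current from `u` uniformly to
the other side. -/
noncomputable def blockPotential {V β : Type*} [Fintype V] (side : V → Bool) (block : V → β)
    (u x : V) : ℝ :=
  ((if x = u then 1 else 0) + (if block u = block x then 1 / oppositeCard side u else 0))
    / (oppositeCard side u + blockCard block u)

/-! ### Potentials and resistances in a join of two disjoint unions of cliques -/

section

variable {V β : Type*} [Fintype V] {G : SimpleGraph V} {side : V → Bool} {block : V → β}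

theorem one_le_blockCard (block : V → β) (u : V) : 1 ≤ blockCard block u := by
  classical
  have h := Finset.single_le_sum (f := fun y : V => if block u = block y then (1 : ℝ) else 0)
    (fun y _ => by positivity) (Finset.mem_univ u)
  simpa [blockCard] using h

theorem blockCard_congr {u v : V} (h : block u = block v) :
    blockCard block u = blockCard block v := by
  rw [blockCard, blockCard, h]

theorem oppositeCard_congr {u v : V} (h : side u = side v) :
    oppositeCard side u = oppositeCard side v := by
  rw [oppositeCard, oppositeCard, h]

theorem blockPotential_self (u : V) (hu : 0 < oppositeCard side u) :
    blockPotential side block u u = (oppositeCard side u + 1)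
      / (oppositeCard side u * (oppositeCard side u + blockCard block u)) := by
  have := one_le_blockCard block u
  simp only [blockPotential, if_true]
  field_simp

theorem blockPotential_of_block_ne {u x : V} (h : block u ≠ block x) :
    blockPotential side block u x = 0 := by
  have hx : x ≠ u := by rintro rfl; exact h rfl
  simp [blockPotential, h, hx]

/-- This total fixes the coefficient $1/d_u$ in the potential: it is the current drained by each
vertex of the opposite side. -/
theorem sum_blockPotential (u : V) (hu : 0 < oppositeCard side u) :
    ∑ y, blockPotential side block u y = 1 / oppositeCard side u := by
  classical
  have h1 := one_le_blockCard block u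
  have h2 : ∑ y : V, (if block u = block y then 1 / oppositeCard side u else 0)
      = blockCard block u * (1 / oppositeCard side u) := by
    rw [blockCard, Finset.sum_mul]
    exact Finset.sum_congr rfl fun y _ => by split_ifs <;> simp
  simp only [blockPotential]
  rw [← Finset.sum_div, Finset.sum_add_distrib, h2, Finset.sum_ite_eq' Finset.univ u]
  simp only [Finset.mem_univ, if_true]
  field_simp

namespace IsJoinOfCliques

-- The degree of $x$ is one less than the coefficient of `φ x`. The excess is harmless because the
-- sum over the block of $x$ includes $y = x$.
open Classical in
theorem laplacian_eq (h : IsJoinOfCliques G side block) (φ : V → ℝ) (x : V) :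
    ∑ y, (if G.Adj x y then φ x - φ y else 0)
      = (oppositeCard side x + blockCard block x) * φ x
        - ∑ y, (if side x ≠ side y then φ y else 0)
        - ∑ y, (if block x = block y then φ y else 0) := by
  rw [oppositeCard, blockCard, add_mul, Finset.sum_mul, Finset.sum_mul, ← Finset.sum_add_distrib,
    ← Finset.sum_sub_distrib, ← Finset.sum_sub_distrib]
  refine Finset.sum_congr rfl fun y _ => ?_
  have hb := h.side_eq (x := x) (y := y)
  simp only [h.adj_iff]
  by_cases hxy : x = y
  · subst hxy; simp
  · by_cases h1 : block x = block y
    · simp [h1, hb h1, hxy]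
    · by_cases h2 : side x = side y <;> simp [h1, h2]

-- On the block of $u$ the factor $d_u+s$ cancels the denominator, and subtracting the block sum
-- $1/d_u$ leaves $1_u$. On the opposite side only the total of the potential is seen, and on other
-- blocks of the side of $u$ nothing is.
open Classical in
theorem laplacian_blockPotential (h : IsJoinOfCliques G side block) (u x : V)
    (hu : 0 < oppositeCard side u) :
    ∑ y, (if G.Adj x y then blockPotential side block u x - blockPotential side block u y else 0)
      = (if x = u then 1 else 0)
        - (if side x ≠ side u then 1 / oppositeCard side u else 0) := by
  have h1 := one_le_blockCard block u
  rw [h.laplacian_eq]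
  by_cases hs : side x = side u
  · have hA : ∑ y, (if side x ≠ side y then blockPotential side block u y else 0) = 0 := by
      refine Finset.sum_eq_zero fun y _ => ?_
      split_ifs with hy
      · exact blockPotential_of_block_ne fun hb => hy (hs.trans (h.side_eq hb))
      · rfl
    rw [hA]
    by_cases hb : block u = block x
    · have hB : ∑ y, (if block x = block y then blockPotential side block u y else 0)
          = 1 / oppositeCard side u := by
        rw [← sum_blockPotential (block := block) u hu]
        refine Finset.sum_congr rfl fun y _ => ?_
        split_ifs with hy
        · rfl
        · exact (blockPotential_of_block_ne (hb ▸ hy)).symm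
      rw [hB, ← blockCard_congr hb, oppositeCard_congr hs]
      simp only [blockPotential, hb, hs, ne_eq, not_true_eq_false, if_true, if_false]
      rw [blockCard_congr hb] at h1 ⊢
      field_simp
      ring
    · have hB : ∑ y, (if block x = block y then blockPotential side block u y else 0) = 0 := by
        refine Finset.sum_eq_zero fun y _ => ?_
        split_ifs with hy
        · exact blockPotential_of_block_ne (hy ▸ hb)
        · rfl
      have hx : x ≠ u := by rintro rfl; exact hb rfl
      rw [hB, blockPotential_of_block_ne hb]
      simp [hx, hs]
  · have hA : ∑ y, (if side x ≠ side y then blockPotential side block u y else 0)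
        = 1 / oppositeCard side u := by
      rw [← sum_blockPotential (block := block) u hu]
      refine Finset.sum_congr rfl fun y _ => ?_
      split_ifs with hy
      · rfl
      · exact (blockPotential_of_block_ne fun hb =>
          hy fun hxy => hs (hxy.trans (h.side_eq hb).symm)).symm
    have hB : ∑ y, (if block x = block y then blockPotential side block u y else 0) = 0 := by
      refine Finset.sum_eq_zero fun y _ => ?_
      split_ifs with hy
      · exact blockPotential_of_block_ne fun hb => hs (h.side_eq (hy.trans hb.symm))
      · rfl
    have hb : block u ≠ block x := fun hb => hs (h.side_eq hb).symm
    have hx : x ≠ u := by rintro rfl; exact hb rfl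
    rw [hA, hB, blockPotential_of_block_ne hb]
    simp [hx, hs]

open Classical in
theorem laplacian_sub_sub (φ ψ χ : V → ℝ) (x : V) :
    ∑ y, (if G.Adj x y then (φ x - ψ x - χ x) - (φ y - ψ y - χ y) else 0)
      = ∑ y, (if G.Adj x y then φ x - φ y else 0) - ∑ y, (if G.Adj x y then ψ x - ψ y else 0)
        - ∑ y, (if G.Adj x y then χ x - χ y else 0) := by
  rw [← Finset.sum_sub_distrib, ← Finset.sum_sub_distrib]
  refine Finset.sum_congr rfl fun y _ => ?_
  split_ifs <;> ring

theorem resistanceDist_of_side_eq (h : IsJoinOfCliques G side block) {u v : V}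
    (huv : side u = side v) (hu : 0 < oppositeCard side u) :
    resistanceDist G u v
      = (blockPotential side block u u - blockPotential side block v u)
        - (blockPotential side block u v - blockPotential side block v v) := by
  classical
  have hv : 0 < oppositeCard side v := oppositeCard_congr huv ▸ hu
  -- No correction is needed on a single side, so the third potential is zero.
  have hφ : IsUnitCurrentPotential G u v
      fun x => blockPotential side block u x - blockPotential side block v x - 0 := by
    intro x
    rw [laplacian_sub_sub _ _ (fun _ => 0), h.laplacian_blockPotential u x hu,
      h.laplacian_blockPotential v x hv, oppositeCard_congr huv, huv]
    simp
  rw [resistanceDist_eq hφ]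
  ring

/-- Within a block the two potentials have equal $1/d_u$ terms, which cancel; only the point masses
at $u$ and $v$ remain. -/
theorem resistanceDist_of_block_eq (h : IsJoinOfCliques G side block) {u v : V} (hne : u ≠ v)
    (huv : block u = block v) (hu : 0 < oppositeCard side u) :
    resistanceDist G u v = 2 / (oppositeCard side u + blockCard block u) := by
  have h1 := one_le_blockCard block u
  rw [h.resistanceDist_of_side_eq (h.side_eq huv) hu]
  simp only [blockPotential, huv, hne, hne.symm, if_true, if_false,
    oppositeCard_congr (h.side_eq huv), blockCard_congr huv]
  ring

/-- Each potential vanishes on the block of the other vertex, so the resistance is the sum of the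
two values at their own sources. -/
theorem resistanceDist_of_block_ne (h : IsJoinOfCliques G side block) {u v : V}
    (hs : side u = side v) (huv : block u ≠ block v) (hu : 0 < oppositeCard side u) :
    resistanceDist G u v
      = (oppositeCard side u + 1)
          / (oppositeCard side u * (oppositeCard side u + blockCard block u))
        + (oppositeCard side u + 1)
          / (oppositeCard side u * (oppositeCard side u + blockCard block v)) := by
  have hv : 0 < oppositeCard side v := oppositeCard_congr hs ▸ hu
  rw [h.resistanceDist_of_side_eq hs hu, blockPotential_of_block_ne huv,
    blockPotential_of_block_ne huv.symm, blockPotential_self u hu, blockPotential_self v hv,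
    oppositeCard_congr hs]
  ring

theorem resistanceDist_of_side_ne (h : IsJoinOfCliques G side block) {u v : V}
    (huv : side u ≠ side v) (hu : 0 < oppositeCard side u) (hv : 0 < oppositeCard side v) :
    resistanceDist G u v
      = (oppositeCard side u + 1)
          / (oppositeCard side u * (oppositeCard side u + blockCard block u))
        + (oppositeCard side v + 1)
          / (oppositeCard side v * (oppositeCard side v + blockCard block v))
        - 1 / (oppositeCard side u * oppositeCard side v) := by
  classical
  -- The drains leave $1_{side(u)}/d_v - 1_{side(v)}/d_u$. The Laplacian of $c\,1_{side(u)}$ is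
  -- $c\,d_u$ on the side of $u$ and $-c\,d_v$ on the other, so $c = 1/(d_u d_v)$ matches both.
  set χ : V → ℝ := fun x =>
    if side x = side u then 1 / (oppositeCard side u * oppositeCard side v) else 0 with hχ
  have hLχ (x : V) : ∑ y, (if G.Adj x y then χ x - χ y else 0)
      = (if side x = side u then 1 / oppositeCard side v else 0)
        - (if side x = side v then 1 / oppositeCard side u else 0) := by
    by_cases hx : side x = side u
    · have hterm (y : V) : (if G.Adj x y then χ x - χ y else 0)
          = (if side u ≠ side y then 1 else 0)
            * (1 / (oppositeCard side u * oppositeCard side v)) := by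
        have hb := h.side_eq (x := x) (y := y)
        simp only [h.adj_iff, hχ, hx] at hb ⊢
        by_cases hy : side u = side y
        · simp [hy]
        · simp [hy, Ne.symm hy]
      rw [Finset.sum_congr rfl fun y _ => hterm y, ← Finset.sum_mul]
      change oppositeCard side u * _ = _
      simp only [hx, huv, if_true, if_false]
      field_simp
      ring
    · have hxv : side x = side v := by
        revert hx huv; cases side x <;> cases side u <;> cases side v <;> simp
      have hterm (y : V) : (if G.Adj x y then χ x - χ y else 0)
          = (if side v ≠ side y then 1 else 0)
            * (-(1 / (oppositeCard side u * oppositeCard side v))) := by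
        have hb := h.side_eq (x := x) (y := y)
        simp only [h.adj_iff, hχ, hxv, huv.symm] at hb ⊢
        by_cases hy : side v = side y
        · have hyu : side y ≠ side u := hy ▸ huv.symm
          simp [hy, hyu]
        · have hyu : side y = side u := by
            revert hy huv; cases side y <;> cases side u <;> cases side v <;> simp
          simp [hyu, huv.symm]
      rw [Finset.sum_congr rfl fun y _ => hterm y, ← Finset.sum_mul]
      change oppositeCard side v * _ = _
      simp only [hxv, huv.symm, if_true, if_false]
      field_simp
      ring
  have hφ : IsUnitCurrentPotential G u v
      fun x => blockPotential side block u x - blockPotential side block v x - χ x := by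
    intro x
    rw [laplacian_sub_sub, h.laplacian_blockPotential u x hu,
      h.laplacian_blockPotential v x hv, hLχ]
    by_cases hx : side x = side u
    · have hxv : side x ≠ side v := hx ▸ huv
      simp only [hx, huv, ne_eq, not_true_eq_false, not_false_eq_true, if_true, if_false]
      ring
    · have hxv : side x = side v := by
        revert hx huv; cases side x <;> cases side u <;> cases side v <;> simp
      simp only [hxv, huv.symm, ne_eq, not_true_eq_false, not_false_eq_true, if_true, if_false]
      ring
  have hb : block u ≠ block v := fun hb => huv (h.side_eq hb)
  rw [resistanceDist_eq hφ, blockPotential_of_block_ne hb, blockPotential_of_block_ne hb.symm,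
    blockPotential_self u hu, blockPotential_self v hv]
  simp only [hχ, huv.symm, if_true, if_false]
  ring

end IsJoinOfCliques

end

/-! ### The blow-up of a star as a join of cliques -/

section

variable {k t : ℕ} {p q : Fin k → ℕ}

/-- Whether a vertex of the blow-up of a star lies in the part of the centre. -/
def blowUpSide [NeZero k] (x : BlowUpVertex t p q) : Bool := decide (x.1 = 0)

/-- The copy of `K_t` or `K_1` that contains a given vertex of a generalized blow-up. -/
def blowUpBlock (x : BlowUpVertex t p q) : Σ i : Fin k, Fin (p i) ⊕ Fin (q i) :=
  ⟨x.1, Sum.map Prod.fst id x.2⟩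

theorem fst_eq_of_blowUpBlock_eq {x y : BlowUpVertex t p q} (h : blowUpBlock x = blowUpBlock y) :
    x.1 = y.1 := by
  have := congrArg Sigma.fst h
  exact this

/-- Adjacency in a star means that exactly one endpoint is the centre, which is precisely a
difference of sides; adjacency inside a part means lying in the same clique. -/
theorem isJoinOfCliques_blowUp [NeZero k] :
    IsJoinOfCliques (generalizedBlowUp (SimpleGraph.starGraph (0 : Fin k)) t p q)
      blowUpSide blowUpBlock where
  side_eq {x y} h := by
    simp [blowUpSide, fst_eq_of_blowUpBlock_eq h]
  adj_iff := by
    rintro ⟨i, x⟩ ⟨j, y⟩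
    simp only [generalizedBlowUp, generalizedJoin, SimpleGraph.starGraph_adj, blowUpSide,
      blowUpBlock]
    refine or_congr ?_ ?_
    · by_cases hi : i = 0 <;> by_cases hj : j = 0 <;> simp [hi, hj] <;> tauto
    · constructor
      · rintro ⟨l, a, b, ha, hb, hab⟩
        cases ha
        cases hb
        rcases x with ⟨a, c⟩ | a <;> rcases b with ⟨b, d⟩ | b <;>
          simp_all [cliquesAndPoints, SimpleGraph.boxProd_adj]
      · rintro ⟨hne, h⟩
        obtain rfl : i = j := fst_eq_of_blowUpBlock_eq (x := ⟨i, x⟩) (y := ⟨j, y⟩) h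
        refine ⟨i, x, y, rfl, rfl, ?_⟩
        rcases x with ⟨a, c⟩ | a <;> rcases y with ⟨b, d⟩ | b <;>
          simp_all [cliquesAndPoints, SimpleGraph.boxProd_adj]

theorem blockCard_of_mem_pointPart {i : Fin k} {u : BlowUpVertex t p q}
    (hu : u ∈ pointPart t p q i) : blockCard blowUpBlock u = 1 := by
  classical
  obtain ⟨b, rfl⟩ := hu
  rw [blockCard, Finset.sum_eq_single ⟨i, Sum.inr b⟩]
  · simp
  · rintro ⟨j, y⟩ - hne
    refine if_neg fun h => hne ?_
    obtain rfl : i = j := fst_eq_of_blowUpBlock_eq h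
    rcases y with y | y <;> simp_all [blowUpBlock]
  · simp

theorem blockCard_of_mem_cliquePart {i : Fin k} {u : BlowUpVertex t p q}
    (hu : u ∈ cliquePart t p q i) : blockCard blowUpBlock u = t := by
  classical
  obtain ⟨⟨a, c⟩, rfl⟩ := hu
  rw [blockCard, Fintype.sum_sigma, Finset.sum_eq_single i]
  · rw [Fintype.sum_sum_type, Fintype.sum_prod_type, Finset.sum_eq_single a]
    · simp [blowUpBlock]
    · intro b _ hb
      simp [blowUpBlock, hb.symm]
    · simp
  · intro j _ hj
    refine Finset.sum_eq_zero fun y _ => if_neg fun h => hj ?_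
    exact (fst_eq_of_blowUpBlock_eq h).symm
  · simp

theorem fst_of_mem_pointPart {i : Fin k} {u : BlowUpVertex t p q}
    (hu : u ∈ pointPart t p q i) : u.1 = i := by
  obtain ⟨b, rfl⟩ := hu; rfl

theorem fst_of_mem_cliquePart {i : Fin k} {u : BlowUpVertex t p q}
    (hu : u ∈ cliquePart t p q i) : u.1 = i := by
  obtain ⟨b, rfl⟩ := hu; rfl

theorem blowUpBlock_ne_of_mem_pointPart {j : Fin k} {u v : BlowUpVertex t p q} (hne : u ≠ v)
    (hv : v ∈ pointPart t p q j) : blowUpBlock u ≠ blowUpBlock v := by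
  obtain ⟨b, rfl⟩ := hv
  obtain ⟨i, x⟩ := u
  intro h
  obtain rfl : i = j := fst_eq_of_blowUpBlock_eq h
  rcases x with x | x <;> simp_all [blowUpBlock]

theorem oppositeCard_of_fst_ne_zero [NeZero k] {u : BlowUpVertex t p q} (hu : u.1 ≠ 0) :
    oppositeCard blowUpSide u = t * p 0 + q 0 := by
  classical
  rw [oppositeCard, Fintype.sum_sigma, Finset.sum_eq_single 0]
  · simp [blowUpSide, hu, mul_comm]
  · intro j _ hj
    simp [blowUpSide, hu, hj]
  · simp

theorem oppositeCard_of_fst_eq_zero [NeZero k] {u : BlowUpVertex t p q} (hu : u.1 = 0) :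
    oppositeCard blowUpSide u
      = Fintype.card (BlowUpVertex t p q) - (t * p 0 + q 0) := by
  classical
  -- The side of the centre is counted directly; the opposite side is its complement.
  have hcard : ((t * p 0 + q 0 : ℝ))
      = ∑ y : BlowUpVertex t p q, if blowUpSide u = blowUpSide y then 1 else 0 := by
    rw [Fintype.sum_sigma, Finset.sum_eq_single 0]
    · simp [blowUpSide, hu, mul_comm]
    · intro j _ hj
      simp [blowUpSide, hu, hj]
    · simp
  rw [eq_sub_iff_add_eq, hcard, oppositeCard, ← Finset.sum_add_distrib]
  rw [Finset.sum_congr rfl (g := fun _ => (1 : ℝ)) fun y _ => ?_]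
  · simp
  · by_cases hy : blowUpSide u = blowUpSide y <;> simp [hy]

end

/-! ### The resistance formulas for the blow-up of a star -/

theorem corollaryc36 (k : ℕ) [NeZero k] (hk : 2 ≤ k) (t : ℕ) (p q : Fin k → ℕ)
    (hpart : ∀ i, 0 < t * p i + q i)
    (G : SimpleGraph (BlowUpVertex t p q))
    (hG : G = generalizedBlowUp (SimpleGraph.starGraph (0 : Fin k)) t p q)
    (n n₁ : ℝ) (hn : n = Fintype.card (BlowUpVertex t p q)) (hn₁ : n₁ = t * p 0 + q 0) :
    -- both vertices in the part of the centre
    (∀ u v : BlowUpVertex t p q, u ≠ v →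
      (u ∈ pointPart t p q 0 → v ∈ pointPart t p q 0 →
        resistanceDist G u v = 2 / (n - n₁)) ∧
      (u ∈ cliquePart t p q 0 → v ∈ pointPart t p q 0 →
        resistanceDist G u v = (2 * (n - n₁) + t + 1) / ((n - n₁) * (t + n - n₁))) ∧
      (u ∈ cliquePart t p q 0 → v ∈ cliquePart t p q 0 → G.Adj u v →
        resistanceDist G u v = 2 / (t + n - n₁)) ∧
      (u ∈ cliquePart t p q 0 → v ∈ cliquePart t p q 0 → ¬ G.Adj u v →
        resistanceDist G u v = 2 * (1 + n - n₁) / ((n - n₁) * (t + n - n₁)))) ∧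
    -- both vertices in the part of the same leaf `i`
    (∀ i : Fin k, i ≠ 0 → ∀ u v : BlowUpVertex t p q, u ≠ v →
      (u ∈ pointPart t p q i → v ∈ pointPart t p q i →
        resistanceDist G u v = 2 / n₁) ∧
      (u ∈ cliquePart t p q i → v ∈ pointPart t p q i →
        resistanceDist G u v = (2 * n₁ + t + 1) / (n₁ * (n₁ + t))) ∧
      (u ∈ cliquePart t p q i → v ∈ cliquePart t p q i → G.Adj u v →
        resistanceDist G u v = 2 / (n₁ + t)) ∧
      (u ∈ cliquePart t p q i → v ∈ cliquePart t p q i → ¬ G.Adj u v →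
        resistanceDist G u v = 2 * (n₁ + 1) / (n₁ * (n₁ + t)))) ∧
    -- `u` in the part of the centre, `v` in the part of a leaf `i`
    (∀ i : Fin k, i ≠ 0 → ∀ u v : BlowUpVertex t p q,
      (u ∈ pointPart t p q 0 → v ∈ pointPart t p q i →
        resistanceDist G u v = (n - 1) / (n₁ * (n - n₁))) ∧
      (u ∈ pointPart t p q 0 → v ∈ cliquePart t p q i →
        resistanceDist G u v = (n₁ - 1) / (n₁ * (n - n₁)) + (n₁ + 1) / (n₁ * (t + n₁))) ∧
      (u ∈ cliquePart t p q 0 → v ∈ pointPart t p q i →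
        resistanceDist G u v = (n - n₁ + 1) / ((n - n₁) * (n - n₁ + t))
          + (n - n₁ - 1) / (n₁ * (n - n₁))) ∧
      (u ∈ cliquePart t p q 0 → v ∈ cliquePart t p q i →
        resistanceDist G u v
          = ((n₁ - 1) * (n - n₁ + 1) + 1 - t) / (n₁ * (n - n₁) * (n - n₁ + t))
            + (n₁ + 1) / (n₁ * (t + n₁)))) ∧
    -- `u` and `v` in the parts of two distinct leaves `i` and `j`
    (∀ i j : Fin k, i ≠ 0 → j ≠ 0 → i ≠ j → ∀ u v : BlowUpVertex t p q,
      (u ∈ pointPart t p q i → v ∈ pointPart t p q j →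
        resistanceDist G u v = 2 / n₁) ∧
      (u ∈ cliquePart t p q i → v ∈ pointPart t p q j →
        resistanceDist G u v = (2 * n₁ + t + 1) / (n₁ * (n₁ + t))) ∧
      (u ∈ cliquePart t p q i → v ∈ cliquePart t p q j →
        resistanceDist G u v = 2 * (n₁ + 1) / (n₁ * (n₁ + t)))) := by
  subst hG
  have hJ := isJoinOfCliques_blowUp (k := k) (t := t) (p := p) (q := q)
  have ht : (0 : ℝ) ≤ t := t.cast_nonneg
  have hpos : 0 < n₁ := by rw [hn₁]; exact_mod_cast hpart 0
  have hO0 {u : BlowUpVertex t p q} (hu : u.1 = 0) : oppositeCard blowUpSide u = n - n₁ := by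
    rw [oppositeCard_of_fst_eq_zero hu, hn, hn₁]
  have hO1 {u : BlowUpVertex t p q} (hu : u.1 ≠ 0) : oppositeCard blowUpSide u = n₁ := by
    rw [oppositeCard_of_fst_ne_zero hu, hn₁]
  have hm : 0 < n - n₁ := by
    have hex (i : Fin k) : Nonempty ((Fin (p i) × Fin t) ⊕ Fin (q i)) := by
      rw [← Fintype.card_pos_iff]
      simpa [mul_comm] using hpart i
    obtain ⟨x⟩ := hex 0
    -- Since $k \ge 2$, vertex $1$ is a leaf, and its nonempty part makes the side of the leaves
    -- nonempty.
    obtain ⟨y⟩ := hex ⟨1, hk⟩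
    rw [← hO0 (u := ⟨0, x⟩) rfl, oppositeCard]
    refine Finset.sum_pos' (fun y _ => by positivity) ⟨⟨⟨1, hk⟩, y⟩, Finset.mem_univ _, ?_⟩
    simp [blowUpSide, Fin.ext_iff]
  have hside {u v : BlowUpVertex t p q} (hu : u.1 ≠ 0) (hv : v.1 ≠ 0) :
      blowUpSide u = blowUpSide v := by simp [blowUpSide, hu, hv]
  have hside0 {u v : BlowUpVertex t p q} (hu : u.1 = 0) (hv : v.1 = 0) :
      blowUpSide u = blowUpSide v := by simp [blowUpSide, hu, hv]
  have hsides {u v : BlowUpVertex t p q} (hu : u.1 = 0) (hv : v.1 ≠ 0) :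
      blowUpSide u ≠ blowUpSide v := by simp [blowUpSide, hu, hv]
  -- two vertices of one side
  have same {N : ℝ} (hN : 0 < N) {u v : BlowUpVertex t p q}
      (hu : oppositeCard blowUpSide u = N) (hs : blowUpSide u = blowUpSide v)
      (hb : blowUpBlock u ≠ blowUpBlock v) :
      resistanceDist (generalizedBlowUp (SimpleGraph.starGraph (0 : Fin k)) t p q) u v
        = (N + 1) / (N * (N + blockCard blowUpBlock u))
          + (N + 1) / (N * (N + blockCard blowUpBlock v)) := by
    rw [hJ.resistanceDist_of_block_ne hs hb (hu ▸ hN), hu]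
  have sameClique {N : ℝ} (hN : 0 < N) {u v : BlowUpVertex t p q} (hne : u ≠ v)
      (hu : oppositeCard blowUpSide u = N) (hs : blowUpSide u = blowUpSide v)
      (hadj : (generalizedBlowUp (SimpleGraph.starGraph (0 : Fin k)) t p q).Adj u v) :
      resistanceDist (generalizedBlowUp (SimpleGraph.starGraph (0 : Fin k)) t p q) u v
        = 2 / (N + blockCard blowUpBlock u) := by
    have hb := ((hJ.adj_iff u v).1 hadj).resolve_left (not_not.2 hs)
    rw [hJ.resistanceDist_of_block_eq hne hb.2 (hu ▸ hN), hu]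
  have block_ne {u v : BlowUpVertex t p q} (hne : u ≠ v)
      (hadj : ¬ (generalizedBlowUp (SimpleGraph.starGraph (0 : Fin k)) t p q).Adj u v) :
      blowUpBlock u ≠ blowUpBlock v :=
    fun hb => hadj ((hJ.adj_iff u v).2 (Or.inr ⟨hne, hb⟩))
  have block_ne_of_fst {u v : BlowUpVertex t p q} (h : u.1 ≠ v.1) :
      blowUpBlock u ≠ blowUpBlock v := fun hb => h (fst_eq_of_blowUpBlock_eq hb)
  have cross {u v : BlowUpVertex t p q} (hu : u.1 = 0) (hv : v.1 ≠ 0) :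
      resistanceDist (generalizedBlowUp (SimpleGraph.starGraph (0 : Fin k)) t p q) u v
        = (n - n₁ + 1) / ((n - n₁) * (n - n₁ + blockCard blowUpBlock u))
          + (n₁ + 1) / (n₁ * (n₁ + blockCard blowUpBlock v)) - 1 / ((n - n₁) * n₁) := by
    rw [hJ.resistanceDist_of_side_ne (hsides hu hv) (hO0 hu ▸ hm) (hO1 hv ▸ hpos), hO0 hu, hO1 hv]
  -- With $m = n - n_1$ as a variable, all denominators are products of visibly positive terms.
  obtain ⟨m, rfl⟩ : ∃ m, n = m + n₁ := ⟨n - n₁, by ring⟩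
  rw [show (t : ℝ) + (m + n₁) - n₁ = t + m by ring, show 1 + (m + n₁) - n₁ = 1 + m by ring]
  simp only [add_sub_cancel_right] at *
  have point {i : Fin k} {u} (hu : u ∈ pointPart t p q i) := blockCard_of_mem_pointPart hu
  have clique {i : Fin k} {u} (hu : u ∈ cliquePart t p q i) := blockCard_of_mem_cliquePart hu
  refine ⟨fun u v hne => ⟨fun hu hv => ?_, fun hu hv => ?_, fun hu hv h => ?_, fun hu hv h => ?_⟩,
    fun i hi u v hne => ⟨fun hu hv => ?_, fun hu hv => ?_, fun hu hv h => ?_, fun hu hv h => ?_⟩,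
    fun i hi u v => ⟨fun hu hv => ?_, fun hu hv => ?_, fun hu hv => ?_, fun hu hv => ?_⟩,
    fun i j hi hj hij u v => ⟨fun hu hv => ?_, fun hu hv => ?_, fun hu hv => ?_⟩⟩
  all_goals
    have hu1 := by first | exact fst_of_mem_pointPart hu | exact fst_of_mem_cliquePart hu
    have hv1 := by first | exact fst_of_mem_pointPart hv | exact fst_of_mem_cliquePart hv
    have hu2 := by first | exact point hu | exact clique hu
    have hv2 := by first | exact point hv | exact clique hv
  · rw [same hm (hO0 hu1) (hside0 hu1 hv1) (blowUpBlock_ne_of_mem_pointPart hne hv), hu2, hv2]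
    field_simp; ring
  · rw [same hm (hO0 hu1) (hside0 hu1 hv1) (blowUpBlock_ne_of_mem_pointPart hne hv), hu2, hv2]
    field_simp; ring
  · rw [sameClique hm hne (hO0 hu1) (hside0 hu1 hv1) h, hu2, add_comm]
  · rw [same hm (hO0 hu1) (hside0 hu1 hv1) (block_ne hne h), hu2, hv2]
    field_simp; ring
  · rw [same hpos (hO1 (hu1 ▸ hi)) (hside (hu1 ▸ hi) (hv1 ▸ hi))
      (blowUpBlock_ne_of_mem_pointPart hne hv), hu2, hv2]
    field_simp; ring
  · rw [same hpos (hO1 (hu1 ▸ hi)) (hside (hu1 ▸ hi) (hv1 ▸ hi))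
      (blowUpBlock_ne_of_mem_pointPart hne hv), hu2, hv2]
    field_simp; ring
  · rw [sameClique hpos hne (hO1 (hu1 ▸ hi)) (hside (hu1 ▸ hi) (hv1 ▸ hi)) h, hu2]
  · rw [same hpos (hO1 (hu1 ▸ hi)) (hside (hu1 ▸ hi) (hv1 ▸ hi)) (block_ne hne h), hu2, hv2]
    field_simp; ring
  · rw [cross hu1 (hv1 ▸ hi), hu2, hv2]
    field_simp; ring
  · rw [cross hu1 (hv1 ▸ hi), hu2, hv2]
    field_simp; ring
  · rw [cross hu1 (hv1 ▸ hi), hu2, hv2]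
    field_simp; ring
  · rw [cross hu1 (hv1 ▸ hi), hu2, hv2]
    field_simp; ring
  -- Parts of distinct leaves lie on one side in different blocks, hence the same formulas as for
  -- non-adjacent vertices of a single leaf part.
  all_goals
    rw [same hpos (hO1 (hu1 ▸ hi)) (hside (hu1 ▸ hi) (hv1 ▸ hj))
      (block_ne_of_fst (hu1 ▸ hv1 ▸ hij)), hu2, hv2]
    field_simp
    ring
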